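/- Let $M\ge N\ge 2$ and let $A=U\Sigma V^T\in\mathbb{R}^{M\times N}$ be a singular value decomposition, with $U=[u_1,\dots,u_M]$ and $V=[v_1,\dots,v_N]$ orthogonal and $\Sigma=\mathrm{diag}\{\sigma_1,\dots,\sigma_N\}\in\mathbb{R}^{M\times N}$, $\sigma_i\ge 0$. Let $\tau\ge 0$ and let the singular values be labeled so that $$|\sigma_1-\tau|<|\sigma_2-\tau|\le\dots\le|\sigma_N-\tau| .$$ Denote by $\sigma_{\max}\ge\sigma_{\max,2}$ the largest and second largest, and by $\sigma_{\min}\le\sigma_{\min,2}$ the smallest and second smallest singular values of $A$ (counted with multiplicity). Consider the correction equation $B_1w=-r$ with $$B_1=\begin{bmatrix} I-u_1u_1^T&\\&I-v_1v_1^T\end{bmatrix}\begin{bmatrix}-\tau I&A\\A^T&-\tau I\end{bmatrix}\begin{bmatrix} I-u_1u_1^T&\\&I-v_1v_1^T\end{bmatrix}\in\mathbb{R}^{(M+N)\times(M+N)},$$ where $r=(r_1,r_2)\ne 0$, with $r_1\in\mathbb{R}^M$ and $r_2\in\mathbb{R}^N$, is any vector with $r_1\perp u_1$ and $r_2\perp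 v_1$. For $j\ge 0$ let $w_j$ be the $j$-th MINRES iterate with zero initial guess, that is, $w_j$ minimizes $\|B_1w+r\|$ over $w\in\mathrm{span}\{r,B_1r,\dots,B_1^{j-1}r\}$, and let $r_{\mathrm{in},j}=B_1w_j+r$. Here $\|\cdot\|$ is the Euclidean norm and $[x]$ is the integer part of $x$ (with $[-\tfrac12]=0$). Then, for all $j\geq 0$: (i) if $\tau>(\sigma_{\max}+\sigma_{\max,2})/2$, then $\sigma_1=\sigma_{\max}$ and $$\frac{\|r_{\mathrm{in},j}\|}{\|r\|}\le 2\left(1-\frac{2}{1+\sqrt{(\tau+\sigma_{\max,2})/(\tau-\sigma_{\max,2})}}\right)^{j};$$ (ii) if $\tau>0$ and $\sigma_{\min}\le\tau<(\sigma_{\min}+\sigma_{\min,2})/2$, then $\sigma_1=\sigma_{\min}$ and $$\frac{\|r_{\mathrm{in},j}\|}{\|r\|}\le 2\left(\frac{\sigma_{\max}}{\tau}\right)^{j_o}\left(1-\frac{2}{1+\sqrt{(\sigma_{\max}^2-\tau^2)/(\sigma_{\min,2}^2-\tau^2)}}\right)^{\left[\frac{j-j_o}{2}\right]},\qquad j_o=\min\{1,M-N\};$$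 (iii) if $(\sigma_{\min}+\sigma_{\min,2})/2<\tau<(\sigma_{\max}+\sigma_{\max,2})/2$, then $\sigma_1\ne\sigma_{\max}$, $\sigma_1\neq\sigma_{\min}$ and $$\frac{\|r_{\mathrm{in},j}\|}{\|r\|}\le 2\left(1-\frac{2}{1+(\sigma_{\max}+\tau)/|\tau-\sigma_2|}\right)^{\left[\frac{j}{2}\right]}.$$ (Here $0^0=1$.) -/

import Mathlib

open Matrix

noncomputable section

/-- The rectangular diagonal `M × N` matrix with diagonal entries `σ`. -/
def rectDiag {M N : ℕ} (σ : Fin N → ℝ) : Matrix (Fin M) (Fin N) ℝ :=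
  Matrix.of fun i k => if (i : ℕ) = (k : ℕ) then σ k else 0

/-- `A = U Σ Vᵀ` is a singular value decomposition of `A ∈ ℝ^{M × N}` (used for `N ≤ M`), with the
nonnegative singular values `σ` labeled in an arbitrary order. The singular vectors are the
columns of `U` and `V`. -/
structure IsSVD {M N : ℕ} (A : Matrix (Fin M) (Fin N) ℝ) (U : Matrix (Fin M) (Fin M) ℝ)
    (σ : Fin N → ℝ) (V : Matrix (Fin N) (Fin N) ℝ) : Prop where
  left_orthogonal : U ∈ Matrix.orthogonalGroup (Fin M) ℝ
  right_orthogonal : V ∈ Matrix.orthogonalGroup (Fin N) ℝ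
  nonneg : ∀ i, 0 ≤ σ i
  eq_mul : A = U * (rectDiag σ : Matrix (Fin M) (Fin N) ℝ) * Vᵀ

/-- The `(k+1)`-th smallest among the values of `σ`, counted with multiplicity. -/
def kthSmallest {N : ℕ} (σ : Fin N → ℝ) (k : Fin N) : ℝ := σ (Tuple.sort σ k)

/-- The `(k+1)`-th largest among the values of `σ`, counted with multiplicity. -/
def kthLargest {N : ℕ} (σ : Fin N → ℝ) (k : Fin N) : ℝ := σ (Tuple.sort σ k.rev)

/-- The augmented matrix `[-τ I, A; Aᵀ, -τ I]`. -/
def augmentedMatrix {M N : ℕ} (A : Matrix (Fin M) (Fin N) ℝ) (τ : ℝ) :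
    Matrix (Fin M ⊕ Fin N) (Fin M ⊕ Fin N) ℝ :=
  Matrix.fromBlocks (-τ • 1) A Aᵀ (-τ • 1)

/-- The matrix `diag(I - u uᵀ, I - v vᵀ)`. -/
def pairProjector {M N : ℕ} (u : Fin M → ℝ) (v : Fin N → ℝ) :
    Matrix (Fin M ⊕ Fin N) (Fin M ⊕ Fin N) ℝ :=
  Matrix.fromBlocks (1 - Matrix.vecMulVec u u) 0 0 (1 - Matrix.vecMulVec v v)

/-- The coefficient matrix of the (standard) correction equation for the approximate left and
right singular vectors `u` and `v`, as an operator on `ℝ^{M+N}` with its Euclidean norm. -/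
def correctionOperator {M N : ℕ} (A : Matrix (Fin M) (Fin N) ℝ) (τ : ℝ)
    (u : Fin M → ℝ) (v : Fin N → ℝ) :
    EuclideanSpace ℝ (Fin M ⊕ Fin N) →ₗ[ℝ] EuclideanSpace ℝ (Fin M ⊕ Fin N) :=
  Matrix.toEuclideanLin (pairProjector u v * augmentedMatrix A τ * pairProjector u v)

/-- `w = (s, t)` satisfies `s ⟂ u` and `t ⟂ v`. -/
def DoublyOrthogonal {M N : ℕ} (w : EuclideanSpace ℝ (Fin M ⊕ Fin N))
    (u : Fin M → ℝ) (v : Fin N → ℝ) : Prop :=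
  (∑ i, w (Sum.inl i) * u i = 0) ∧ (∑ k, w (Sum.inr k) * v k = 0)

section Minres

variable {E : Type*} [NormedAddCommGroup E] [InnerProductSpace ℝ E]

/-- The Krylov subspace `K_j(T, b) = span {b, T b, …, T^(j-1) b}`. -/
def krylov (T : E →ₗ[ℝ] E) (b : E) (j : ℕ) : Submodule ℝ E :=
  Submodule.span ℝ (Set.range fun i : Fin j => (T ^ (i : ℕ)) b)

/-- `w` is the `j`-th iterate of MINRES, with zero initial guess, for the linear system `T w = b`
with symmetric `T`: it minimizes the residual norm over the `j`-th Krylov subspace. -/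
def IsMinresIterate (T : E →ₗ[ℝ] E) (b : E) (j : ℕ) (w : E) : Prop :=
  w ∈ krylov T b j ∧ ∀ w' ∈ krylov T b j, ‖b - T w‖ ≤ ‖b - T w'‖

/-- MINRES iterates exist for every `j`. -/
theorem exists_isMinresIterate (T : E →ₗ[ℝ] E) (b : E) (j : ℕ) :
    ∃ w, IsMinresIterate T b j w := by
  have : FiniteDimensional ℝ (krylov T b j) :=
    FiniteDimensional.span_of_finite ℝ (Set.finite_range _)
  let K := (krylov T b j).map T
  obtain ⟨w, hw, hwy⟩ := (Submodule.mem_map).1 (K.starProjection_apply_mem b)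
  refine ⟨w, hw, fun w' hw' => ?_⟩
  rw [hwy, Submodule.starProjection_minimal]
  exact ciInf_le ⟨0, by rintro _ ⟨_, rfl⟩; exact norm_nonneg _⟩
    (⟨T w', Submodule.mem_map_of_mem hw'⟩ : K)

end Minres

end

/-! MINRES makes `p(B₁) r` as short as possible over polynomials of degree at most `j` with `p(0) =
1`, so any single such `p` gives an upper bound. Since `B₁` is symmetric, only the size of `p` at
eigenvalues with an eigenvector not orthogonal to `r` matters. As `r` is doubly orthogonal, these
are among `-τ ± σ i` with `i ≠ 0`, together with `-τ` when `N < M`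
(`IsSVD.correctionOperator_eigenvalue`). Each estimate then composes a scaled Chebyshev polynomial
(`exists_polynomial_abs_eval_le`) with a map sending these eigenvalues into a positive interval. In
(i) they are all negative and `c ↦ -c` works. In (ii) the map is `c ↦ (c + τ)² - τ²`, with values `σ
i² - τ²`; the exception `-τ` is removed by a factor `1 + c/τ`, of modulus at most `σmax/τ`
elsewhere. In (iii) the spectrum is indefinite and `c ↦ c²` is used. The quadratic maps halve the
available degree. -/

/-! ### MINRES and residual polynomials -/

open Polynomial in
/-- An eigenvector of a symmetric operator is an eigenvector of every polynomial in it. -/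
theorem LinearMap.IsSymmetric.inner_aeval_apply {E : Type*} [NormedAddCommGroup E]
    [InnerProductSpace ℝ E] {T : E →ₗ[ℝ] E} (hT : T.IsSymmetric) {e : E} {c : ℝ}
    (he : T e = c • e) (p : ℝ[X]) (r : E) :
    inner ℝ e (aeval T p r) = p.eval c * inner ℝ e r := by
  have hpow : ∀ n : ℕ, inner ℝ e ((T ^ n) r) = c ^ n * inner ℝ e r := by
    intro n
    induction n with
    | zero => simp
    | succ n ih =>
      rw [pow_succ', Module.End.mul_apply, ← hT, he, real_inner_smul_left, ih]
      ring
  induction p using Polynomial.induction_on' with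
  | add p q hp hq => simp [inner_add_right, hp, hq, add_mul]
  | monomial n a =>
    rw [aeval_monomial, eval_monomial, Module.End.mul_apply, Module.algebraMap_end_apply,
      real_inner_smul_right, hpow]
    ring

-- Parseval in an orthonormal eigenbasis: basis vectors orthogonal to `r` contribute nothing, so
-- their eigenvalues need no bound.
open Polynomial in
theorem LinearMap.IsSymmetric.norm_aeval_apply_le {E : Type*} [NormedAddCommGroup E]
    [InnerProductSpace ℝ E] [FiniteDimensional ℝ E] {T : E →ₗ[ℝ] E} (hT : T.IsSymmetric)
    (p : ℝ[X]) (r : E) {C : ℝ} (hC : 0 ≤ C)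
    (h : ∀ (e : E) (c : ℝ), T e = c • e → inner ℝ e r ≠ 0 → |p.eval c| ≤ C) :
    ‖aeval T p r‖ ≤ C * ‖r‖ := by
  refine (sq_le_sq₀ (norm_nonneg _) (by positivity)).1 ?_
  let b := hT.eigenvectorBasis rfl
  rw [mul_pow, ← b.sum_sq_norm_inner_right, ← b.sum_sq_norm_inner_right r, Finset.mul_sum]
  refine Finset.sum_le_sum fun i _ => ?_
  have he : T (b i) = hT.eigenvalues rfl i • b i := hT.apply_eigenvectorBasis rfl i
  rw [hT.inner_aeval_apply he, norm_mul, mul_pow]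
  by_cases h0 : inner ℝ (b i) r = 0
  · simp [h0]
  · gcongr
    exact h _ _ he h0

open Polynomial in
theorem aeval_mem_krylov {E : Type*} [NormedAddCommGroup E] [InnerProductSpace ℝ E]
    (T : E →ₗ[ℝ] E) (b : E) {j : ℕ} {q : ℝ[X]} (hq : ∀ i, j ≤ i → q.coeff i = 0) :
    aeval T q b ∈ krylov T b j := by
  rw [aeval_eq_sum_range, LinearMap.sum_apply]
  refine Submodule.sum_mem _ fun i _ => ?_
  by_cases hi : i < j
  · exact Submodule.smul_mem _ _ (Submodule.subset_span ⟨⟨i, hi⟩, rfl⟩)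
  · simp [hq i (by omega)]

open Polynomial in
/-- The MINRES residual is bounded by the maximum over the spectrum of any residual polynomial of
admissible degree. -/
theorem IsMinresIterate.norm_residual_le {E : Type*} [NormedAddCommGroup E]
    [InnerProductSpace ℝ E] [FiniteDimensional ℝ E] {T : E →ₗ[ℝ] E} (hT : T.IsSymmetric)
    {r w : E} {j : ℕ} (hw : IsMinresIterate T (-r) j w) {p : ℝ[X]} (hp : p.natDegree ≤ j)
    (hp0 : p.eval 0 = 1) {C : ℝ} (hC : 0 ≤ C)
    (h : ∀ (e : E) (c : ℝ), T e = c • e → inner ℝ e r ≠ 0 → |p.eval c| ≤ C) :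
    ‖T w + r‖ ≤ C * ‖r‖ := by
  -- From `p = X * p.divX + 1`, the competitor `p.divX(T) r` has residual `-p(T) r`.
  have hmem : -aeval T p.divX (-r) ∈ krylov T (-r) j := by
    refine Submodule.neg_mem _ (aeval_mem_krylov T _ fun i hi => ?_)
    rw [coeff_divX]
    exact coeff_eq_zero_of_natDegree_lt (by omega)
  have hle := hw.2 _ hmem
  have hres : -r - T (-aeval T p.divX (-r)) = -aeval T p r := by
    have hpX : p = X * p.divX + Polynomial.C 1 := by
      rw [← hp0, ← coeff_zero_eq_eval_zero, X_mul_divX_add]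
    conv_rhs => rw [hpX]
    simp [sub_eq_add_neg, add_comm]
  rw [hres, norm_neg] at hle
  calc ‖T w + r‖ = ‖-r - T w‖ := by rw [← norm_neg]; congr 1; abel
    _ ≤ _ := hle
    _ ≤ _ := hT.norm_aeval_apply_le p r hC h

/-! ### Chebyshev polynomials on a positive interval -/

-- `T_n(cosh x) = cosh (n x)` at `x = log z`, with the term `exp (-n x)` dropped.
open Polynomial in
theorem half_pow_le_eval_T {z : ℝ} (hz : 0 < z) (n : ℕ) :
    z ^ n / 2 ≤ (Chebyshev.T ℝ n).eval ((z + z⁻¹) / 2) := by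
  have h1 : (z + z⁻¹) / 2 = Real.cosh (Real.log z) := by
    rw [Real.cosh_eq, Real.exp_neg, Real.exp_log hz]
  rw [h1, Chebyshev.T_real_cosh, Real.cosh_eq]
  have h2 : Real.exp (((n : ℤ) : ℝ) * Real.log z) = z ^ n := by
    rw [Int.cast_natCast, Real.exp_nat_mul, Real.exp_log hz]
  rw [h2]
  have := Real.exp_pos (-(((n : ℤ) : ℝ) * Real.log z))
  linarith

theorem one_sub_two_div_one_add_nonneg {x : ℝ} (hx : 1 ≤ x) : 0 ≤ 1 - 2 / (1 + x) := by
  rw [sub_nonneg, div_le_one (by linarith)]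
  linarith

theorem one_sub_two_div_one_add_sqrt_nonneg {a b : ℝ} (ha : 0 < a) (hab : a ≤ b) :
    0 ≤ 1 - 2 / (1 + √(b / a)) :=
  one_sub_two_div_one_add_nonneg (Real.one_le_sqrt.2 ((one_le_div ha).2 hab))

open Polynomial in
/-- The scaled and shifted Chebyshev polynomials are small on `[a, b]` and equal to `1` at `0`. -/
theorem exists_polynomial_abs_eval_le {a b : ℝ} (ha : 0 < a) (hab : a ≤ b) (n : ℕ) :
    ∃ q : ℝ[X], q.natDegree ≤ n ∧ q.eval 0 = 1 ∧
      ∀ t, a ≤ t → t ≤ b → |q.eval t| ≤ 2 * (1 - 2 / (1 + √(b / a))) ^ n := by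
  rcases hab.eq_or_lt with rfl | hlt
  -- A one-point interval cannot be rescaled to `[-1, 1]`; the bound is then `2 * 0 ^ n`, so a root
  -- at `a` is needed for `n > 0`.
  · refine ⟨(1 - C a⁻¹ * X) ^ n, ?_, by simp, fun t h1 h2 => ?_⟩
    · refine natDegree_pow_le.trans ?_
      have : (1 - C a⁻¹ * X : ℝ[X]).natDegree ≤ 1 := by compute_degree
      nlinarith
    · obtain rfl : t = a := le_antisymm h2 h1
      have : (1 : ℝ) + 1 = 2 := by norm_num
      simp only [eval_pow, eval_sub, eval_one, eval_mul, eval_C, eval_X, inv_mul_cancel₀ ha.ne',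
        div_self ha.ne', Real.sqrt_one, this, div_self (two_ne_zero' ℝ), sub_self]
      rcases n with _ | n <;> simp
  have hd : 0 < b - a := by linarith
  have hsa : 0 < √a := Real.sqrt_pos.2 ha
  have hsab : √a < √b := Real.sqrt_lt_sqrt ha.le hlt
  have ha2 : √a ^ 2 = a := Real.sq_sqrt ha.le
  have hb2 : √b ^ 2 = b := Real.sq_sqrt (by linarith)
  have hs : 0 < √b - √a := by linarith
  have hs' : 0 < √b + √a := by linarith
  -- The solution `z > 1` of `(z + z⁻¹) / 2 = (b + a) / (b - a)`; its inverse is the convergence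
  -- rate.
  set z : ℝ := (√b + √a) / (√b - √a) with hz
  have hz0 : 0 < z := by positivity
  have hx0 : (b + a) / (b - a) = (z + z⁻¹) / 2 := by
    rw [hz, inv_div, div_eq_div_iff hd.ne' two_ne_zero, div_add_div _ _ hs.ne' hs'.ne',
      div_mul_eq_mul_div, eq_div_iff (by positivity), ← ha2, ← hb2]
    simp only [Real.sqrt_sq (Real.sqrt_nonneg _)]
    ring
  have hρ : 1 - 2 / (1 + √(b / a)) = z⁻¹ := by
    rw [Real.sqrt_div (by linarith), hz]
    field_simp
    ring
  have hT := half_pow_le_eval_T hz0 n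
  rw [← hx0] at hT
  set D := (Chebyshev.T ℝ n).eval ((b + a) / (b - a)) with hD
  have hzn : 0 < z ^ n := by positivity
  have hD0 : 0 < D := by linarith
  -- The affine map takes `[a, b]` onto `[-1, 1]`, reversing it, and `0` to `(b + a) / (b - a)`;
  -- dividing by `D` normalizes the value at `0`.
  refine ⟨C D⁻¹ * (Chebyshev.T ℝ n).comp (C ((b + a) / (b - a)) - C (2 / (b - a)) * X),
    ?_, ?_, fun t h1 h2 => ?_⟩
  · refine (natDegree_C_mul_le _ _).trans (natDegree_comp_le.trans ?_)
    have : (C ((b + a) / (b - a)) - C (2 / (b - a)) * X : ℝ[X]).natDegree ≤ 1 := by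
      compute_degree
    rw [Chebyshev.natDegree_T, Int.natAbs_natCast]
    nlinarith
  · simp [eval_comp, ← hD, hD0.ne']
  · have habs : |(b + a) / (b - a) - 2 / (b - a) * t| ≤ 1 := by
      have : (b + a) / (b - a) - 2 / (b - a) * t = (b + a - 2 * t) / (b - a) := by ring
      rw [this, abs_div, abs_of_pos hd, div_le_one hd, abs_le]
      constructor <;> linarith
    have hT1 := Chebyshev.abs_eval_T_real_le_one n habs
    simp only [eval_mul, eval_C, eval_comp, eval_sub, eval_X, abs_mul, abs_inv, abs_of_pos hD0]
    rw [hρ, inv_pow, ← div_eq_mul_inv]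
    calc D⁻¹ * _ ≤ D⁻¹ * 1 := by gcongr
      _ = 1 / D := by ring
      _ ≤ 2 / z ^ n := by rw [div_le_div_iff₀ hD0 hzn]; linarith

/-! ### Orthogonal columns and singular vectors -/

theorem col_dotProduct_col {n : ℕ} {U : Matrix (Fin n) (Fin n) ℝ}
    (hU : U ∈ Matrix.orthogonalGroup (Fin n) ℝ) (i k : Fin n) :
    U.col i ⬝ᵥ U.col k = if i = k then 1 else 0 := by
  have h := (Matrix.mem_orthogonalGroup_iff' (Fin n) ℝ).1 hU
  simpa [star_eq_conjTranspose, conjTranspose_eq_transpose_of_trivial, Matrix.mul_apply,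
    Matrix.one_apply, dotProduct] using congr_fun₂ h i k

/-- If `r` is orthogonal to the first column of an orthogonal matrix and `x` is not orthogonal to
`r`, then `x` has a component along another column. -/
theorem exists_col_dotProduct_ne_zero {n : ℕ} {U : Matrix (Fin n) (Fin n) ℝ}
    (hU : U ∈ Matrix.orthogonalGroup (Fin n) ℝ) (i₀ : Fin n) {x r : Fin n → ℝ}
    (hr : r ⬝ᵥ U.col i₀ = 0) (hx : x ⬝ᵥ r ≠ 0) : ∃ i, i ≠ i₀ ∧ U.col i ⬝ᵥ x ≠ 0 := by
  by_contra! hcon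
  apply hx
  have h : U * Uᵀ = 1 := (Matrix.mem_orthogonalGroup_iff (Fin n) ℝ).1 hU
  have hpars : x ⬝ᵥ r = (Uᵀ *ᵥ x) ⬝ᵥ (Uᵀ *ᵥ r) := by
    rw [dotProduct_mulVec, vecMul_transpose, mulVec_mulVec, h, one_mulVec]
  rw [hpars]
  refine Finset.sum_eq_zero fun i _ => ?_
  by_cases hi : i = i₀
  · have : (Uᵀ *ᵥ r) i = 0 := by
      rw [hi, ← hr, dotProduct_comm]
      rfl
    rw [this, mul_zero]
  · have : (Uᵀ *ᵥ x) i = 0 := hcon i hi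
    rw [this, zero_mul]

namespace IsSVD

variable {M N : ℕ} {A : Matrix (Fin M) (Fin N) ℝ} {U : Matrix (Fin M) (Fin M) ℝ}
  {σ : Fin N → ℝ} {V : Matrix (Fin N) (Fin N) ℝ}

theorem mulVec_col (hA : IsSVD A U σ V) (hMN : N ≤ M) (k : Fin N) :
    A *ᵥ V.col k = σ k • U.col (Fin.castLE hMN k) := by
  have h : Vᵀ * V = 1 := (Matrix.mem_orthogonalGroup_iff' (Fin N) ℝ).1 hA.right_orthogonal
  have hAV : A * V = U * (rectDiag σ : Matrix (Fin M) (Fin N) ℝ) := by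
    rw [hA.eq_mul, Matrix.mul_assoc, h, Matrix.mul_one]
  ext i
  have hik : (A * V) i k = (U * (rectDiag σ : Matrix (Fin M) (Fin N) ℝ)) i k := by rw [hAV]
  rw [Matrix.mul_apply, Matrix.mul_apply, Finset.sum_eq_single (Fin.castLE hMN k)] at hik
  · simpa [mulVec, dotProduct, rectDiag, mul_comm] using hik
  · intro l _ hl
    have : (l : ℕ) ≠ k := fun h => hl (Fin.ext h)
    simp [rectDiag, this]
  · simp

theorem transpose_mulVec_apply (hA : IsSVD A U σ V) (i : Fin M) (k : Fin N) :
    (Aᵀ *ᵥ U.col i) k = ∑ l : Fin N, V k l * if (i : ℕ) = l then σ l else 0 := by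
  have h : Uᵀ * U = 1 := (Matrix.mem_orthogonalGroup_iff' (Fin M) ℝ).1 hA.left_orthogonal
  have hAU : Aᵀ * U = V * (rectDiag σ : Matrix (Fin M) (Fin N) ℝ)ᵀ := by
    rw [hA.eq_mul, transpose_mul, transpose_mul, transpose_transpose, Matrix.mul_assoc,
      Matrix.mul_assoc, h, Matrix.mul_one]
  have hik : (Aᵀ * U) k i = (V * (rectDiag σ : Matrix (Fin M) (Fin N) ℝ)ᵀ) k i := by rw [hAU]
  rw [Matrix.mul_apply, Matrix.mul_apply] at hik
  simpa [mulVec, dotProduct, rectDiag] using hik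

theorem transpose_mulVec_col (hA : IsSVD A U σ V) (hMN : N ≤ M) (k : Fin N) :
    Aᵀ *ᵥ U.col (Fin.castLE hMN k) = σ k • V.col k := by
  ext l
  rw [hA.transpose_mulVec_apply, Finset.sum_eq_single k]
  · simp [mul_comm]
  · intro m _ hm
    have : (k : ℕ) ≠ m := fun h => hm (Fin.ext h.symm)
    simp [this]
  · simp

theorem transpose_mulVec_col_of_le (hA : IsSVD A U σ V) {i : Fin M} (hi : N ≤ i) :
    Aᵀ *ᵥ U.col i = 0 := by
  ext l
  rw [hA.transpose_mulVec_apply]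
  refine Finset.sum_eq_zero fun m _ => ?_
  have : (i : ℕ) ≠ m := by omega
  simp [this]

end IsSVD

/-! ### Spectrum of the projected augmented matrix -/

theorem one_sub_vecMulVec_mulVec {n : ℕ} {u s : Fin n → ℝ} (h : u ⬝ᵥ s = 0) :
    (1 - vecMulVec u u) *ᵥ s = s := by
  rw [sub_mulVec, one_mulVec, vecMulVec_mulVec, h]
  simp

theorem pairProjector_mulVec {M N : ℕ} {u s : Fin M → ℝ} {v t : Fin N → ℝ} (hs : u ⬝ᵥ s = 0)
    (ht : v ⬝ᵥ t = 0) : pairProjector u v *ᵥ Sum.elim s t = Sum.elim s t := by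
  rw [pairProjector, fromBlocks_mulVec]
  simp [one_sub_vecMulVec_mulVec hs, one_sub_vecMulVec_mulVec ht]

theorem augmentedMatrix_mulVec {M N : ℕ} (A : Matrix (Fin M) (Fin N) ℝ) (τ : ℝ) (s : Fin M → ℝ)
    (t : Fin N → ℝ) : augmentedMatrix A τ *ᵥ Sum.elim s t =
      Sum.elim (-τ • s + A *ᵥ t) (Aᵀ *ᵥ s + -τ • t) := by
  rw [augmentedMatrix, fromBlocks_mulVec]
  simp only [smul_mulVec, one_mulVec, Sum.elim_comp_inl, Sum.elim_comp_inr]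

/-- The last two hypotheses keep the image doubly orthogonal, so neither projector acts. -/
theorem projected_mulVec {M N : ℕ} {A : Matrix (Fin M) (Fin N) ℝ} {τ : ℝ} {u s : Fin M → ℝ}
    {v t : Fin N → ℝ} (hs : u ⬝ᵥ s = 0) (ht : v ⬝ᵥ t = 0) (hs' : u ⬝ᵥ (A *ᵥ t) = 0)
    (ht' : v ⬝ᵥ (Aᵀ *ᵥ s) = 0) :
    (pairProjector u v * augmentedMatrix A τ * pairProjector u v) *ᵥ Sum.elim s t =
      Sum.elim (-τ • s + A *ᵥ t) (Aᵀ *ᵥ s + -τ • t) := by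
  rw [← mulVec_mulVec, ← mulVec_mulVec, pairProjector_mulVec hs ht, augmentedMatrix_mulVec,
    pairProjector_mulVec]
  · simp [dotProduct_add, hs, hs']
  · simp [dotProduct_add, ht, ht']

theorem transpose_projected {M N : ℕ} (A : Matrix (Fin M) (Fin N) ℝ) (τ : ℝ) (u : Fin M → ℝ)
    (v : Fin N → ℝ) :
    (pairProjector u v * augmentedMatrix A τ * pairProjector u v)ᵀ =
      pairProjector u v * augmentedMatrix A τ * pairProjector u v := by
  have hP : (pairProjector u v)ᵀ = pairProjector u v := by
    simp [pairProjector, fromBlocks_transpose, transpose_vecMulVec]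
  have hS : (augmentedMatrix A τ)ᵀ = augmentedMatrix A τ := by
    simp [augmentedMatrix, fromBlocks_transpose]
  rw [transpose_mul, transpose_mul, hP, hS, Matrix.mul_assoc]

theorem isSymmetric_correctionOperator {M N : ℕ} (A : Matrix (Fin M) (Fin N) ℝ) (τ : ℝ)
    (u : Fin M → ℝ) (v : Fin N → ℝ) : (correctionOperator A τ u v).IsSymmetric :=
  isSymmetric_toEuclideanLin_iff.2 <| by
    rw [IsHermitian, conjTranspose_eq_transpose_of_trivial, transpose_projected]

theorem elim_dotProduct {M N : ℕ} (s : Fin M → ℝ) (t : Fin N → ℝ) (e : Fin M ⊕ Fin N → ℝ) :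
    Sum.elim s t ⬝ᵥ e = s ⬝ᵥ (e ∘ Sum.inl) + t ⬝ᵥ (e ∘ Sum.inr) := by
  simp [dotProduct, Fintype.sum_sum_type]

/-- The eigenvalue relation tested against a vector of the invariant subspace. -/
theorem projected_eigen_dotProduct {M N : ℕ} {A : Matrix (Fin M) (Fin N) ℝ} {τ : ℝ}
    {u s : Fin M → ℝ} {v t : Fin N → ℝ} (hs : u ⬝ᵥ s = 0) (ht : v ⬝ᵥ t = 0)
    (hs' : u ⬝ᵥ (A *ᵥ t) = 0) (ht' : v ⬝ᵥ (Aᵀ *ᵥ s) = 0) {e : Fin M ⊕ Fin N → ℝ} {c : ℝ}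
    (he : (pairProjector u v * augmentedMatrix A τ * pairProjector u v) *ᵥ e = c • e) :
    (c + τ) * (s ⬝ᵥ (e ∘ Sum.inl) + t ⬝ᵥ (e ∘ Sum.inr)) =
      (A *ᵥ t) ⬝ᵥ (e ∘ Sum.inl) + (Aᵀ *ᵥ s) ⬝ᵥ (e ∘ Sum.inr) := by
  have h := congr_arg (fun x => Sum.elim s t ⬝ᵥ x) he
  simp only [dotProduct_mulVec, dotProduct_smul] at h
  rw [← mulVec_transpose, transpose_projected, projected_mulVec hs ht hs' ht', elim_dotProduct,
    elim_dotProduct, add_dotProduct, add_dotProduct, smul_dotProduct, smul_dotProduct] at h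
  simp only [smul_eq_mul] at h
  linarith

/-- The eigenvalues of the correction operator that matter for a right-hand side in the doubly
orthogonal subspace. -/
theorem IsSVD.correctionOperator_eigenvalue {M N : ℕ} {A : Matrix (Fin M) (Fin N) ℝ}
    {U : Matrix (Fin M) (Fin M) ℝ} {σ : Fin N → ℝ} {V : Matrix (Fin N) (Fin N) ℝ}
    (hA : IsSVD A U σ V) (hMN : N ≤ M) (i₀ : Fin N) {τ : ℝ}
    {r e : EuclideanSpace ℝ (Fin M ⊕ Fin N)} {c : ℝ}
    (hr : DoublyOrthogonal r (U.col (Fin.castLE hMN i₀)) (V.col i₀))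
    (he : correctionOperator A τ (U.col (Fin.castLE hMN i₀)) (V.col i₀) e = c • e)
    (her : inner ℝ e r ≠ 0) :
    (∃ i, i ≠ i₀ ∧ (c + τ) ^ 2 = σ i ^ 2) ∨ (N < M ∧ c = -τ) := by
  set u := U.col (Fin.castLE hMN i₀) with hu
  set v := V.col i₀ with hv
  set x : Fin M → ℝ := e.ofLp ∘ Sum.inl with hx
  set y : Fin N → ℝ := e.ofLp ∘ Sum.inr with hy
  have he' : (pairProjector u v * augmentedMatrix A τ * pairProjector u v) *ᵥ e.ofLp =
      c • e.ofLp := congr_arg WithLp.ofLp he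
  have hUne : ∀ i, i ≠ Fin.castLE hMN i₀ → u ⬝ᵥ U.col i = 0 := fun i hi => by
    rw [hu, col_dotProduct_col hA.left_orthogonal, if_neg hi.symm]
  have hVne : ∀ i, i ≠ i₀ → v ⬝ᵥ V.col i = 0 := fun i hi => by
    rw [hv, col_dotProduct_col hA.right_orthogonal, if_neg hi.symm]
  have hcast : ∀ i, i ≠ i₀ → Fin.castLE hMN i ≠ Fin.castLE hMN i₀ := fun i hi h =>
    hi (Fin.castLE_injective hMN h)
  -- Testing against `(u_k, 0)` and `(0, v_k)` avoids assuming that `e` itself is doubly orthogonal,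
  -- which can fail for `c = 0`.
  have hleft : ∀ k, k ≠ i₀ →
      (c + τ) * (U.col (Fin.castLE hMN k) ⬝ᵥ x) = σ k * (V.col k ⬝ᵥ y) := fun k hk => by
    have := projected_eigen_dotProduct (A := A) (t := 0) (hUne _ (hcast k hk)) (by simp) (by simp)
      (by rw [hA.transpose_mulVec_col hMN, dotProduct_smul, hVne k hk, smul_zero]) he'
    simpa [hA.transpose_mulVec_col hMN, hx, hy] using this
  have hright : ∀ k, k ≠ i₀ →
      (c + τ) * (V.col k ⬝ᵥ y) = σ k * (U.col (Fin.castLE hMN k) ⬝ᵥ x) := fun k hk => by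
    have := projected_eigen_dotProduct (A := A) (s := 0) (by simp) (hVne k hk)
      (by rw [hA.mulVec_col hMN, dotProduct_smul, hUne _ (hcast k hk), smul_zero]) (by simp) he'
    simpa [hA.mulVec_col hMN, hx, hy] using this
  -- The two relations form a symmetric 2 × 2 system; a nonzero solution forces its determinant to
  -- vanish.
  have key : ∀ k, k ≠ i₀ → (V.col k ⬝ᵥ y ≠ 0 ∨ U.col (Fin.castLE hMN k) ⬝ᵥ x ≠ 0) →
      (c + τ) ^ 2 = σ k ^ 2 := by
    rintro k hk (h | h)
    · refine mul_right_cancel₀ h ?_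
      linear_combination (c + τ) * hright k hk + σ k * hleft k hk
    · refine mul_right_cancel₀ h ?_
      linear_combination (c + τ) * hleft k hk + σ k * hright k hk
  have hsplit : inner ℝ e r = x ⬝ᵥ (r.ofLp ∘ Sum.inl) + y ⬝ᵥ (r.ofLp ∘ Sum.inr) := by
    simp [PiLp.inner_apply, dotProduct, Fintype.sum_sum_type, hx, hy, mul_comm]
  by_cases hy0 : y ⬝ᵥ (r.ofLp ∘ Sum.inr) = 0
  · have hx0 : x ⬝ᵥ (r.ofLp ∘ Sum.inl) ≠ 0 := by
      rwa [hsplit, hy0, add_zero] at her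
    obtain ⟨i, hi, hix⟩ :=
      exists_col_dotProduct_ne_zero hA.left_orthogonal (Fin.castLE hMN i₀) hr.1 hx0
    by_cases hiN : (i : ℕ) < N
    · have hk : (⟨i, hiN⟩ : Fin N) ≠ i₀ := fun h => hi (congr_arg (Fin.castLE hMN) h)
      exact Or.inl ⟨_, hk, key _ hk (Or.inr hix)⟩
    -- The surplus columns of `U` lie in the kernel of `Aᵀ`.
    · refine Or.inr ⟨by omega, ?_⟩
      have := projected_eigen_dotProduct (A := A) (t := 0) (hUne i hi) (by simp) (by simp)
        (by rw [hA.transpose_mulVec_col_of_le (by omega), dotProduct_zero]) he'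
      rw [hA.transpose_mulVec_col_of_le (by omega)] at this
      simp only [mulVec_zero, zero_dotProduct, add_zero, mul_eq_zero] at this
      rcases this with h | h
      · linarith
      · exact absurd h hix
  · obtain ⟨k, hk, hky⟩ := exists_col_dotProduct_ne_zero hA.right_orthogonal i₀ hr.2 hy0
    exact Or.inl ⟨k, hk, key k hk (Or.inl hky)⟩

open Polynomial in
theorem IsSVD.residual_div_le {M N : ℕ} {A : Matrix (Fin M) (Fin N) ℝ}
    {U : Matrix (Fin M) (Fin M) ℝ} {σ : Fin N → ℝ} {V : Matrix (Fin N) (Fin N) ℝ}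
    (hA : IsSVD A U σ V) (hMN : N ≤ M) (i₀ : Fin N) {τ : ℝ}
    {r w : EuclideanSpace ℝ (Fin M ⊕ Fin N)}
    (hr : DoublyOrthogonal r (U.col (Fin.castLE hMN i₀)) (V.col i₀)) {j : ℕ}
    (hw : IsMinresIterate (correctionOperator A τ (U.col (Fin.castLE hMN i₀)) (V.col i₀))
      (-r) j w) {p : ℝ[X]} (hp : p.natDegree ≤ j) (hp0 : p.eval 0 = 1) {C : ℝ} (hC : 0 ≤ C)
    (h : ∀ c, ((∃ i, i ≠ i₀ ∧ (c + τ) ^ 2 = σ i ^ 2) ∨ (N < M ∧ c = -τ)) → |p.eval c| ≤ C) :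
    ‖correctionOperator A τ (U.col (Fin.castLE hMN i₀)) (V.col i₀) w + r‖ / ‖r‖ ≤ C :=
  div_le_of_le_mul₀ (norm_nonneg _) hC <|
    hw.norm_residual_le (isSymmetric_correctionOperator _ _ _ _) hp hp0 hC fun _ c he her =>
      h c (hA.correctionOperator_eigenvalue hMN i₀ hr he her)

/-! ### Extreme singular values and the three estimates -/

/-- Naming indices that attain the values lets ties be handled by comparing indices. -/
theorem exists_kthSmallest {N : ℕ} (hN : 2 ≤ N) (σ : Fin N → ℝ) :
    ∃ a b, a ≠ b ∧ kthSmallest σ ⟨0, by omega⟩ = σ a ∧ kthSmallest σ ⟨1, by omega⟩ = σ b ∧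
      (∀ i, σ a ≤ σ i) ∧ ∀ i, i ≠ a → σ b ≤ σ i := by
  refine ⟨_, _, fun h => ?_, rfl, rfl, fun i => ?_, fun i hi => ?_⟩
  · simpa using (Tuple.sort σ).injective h
  · obtain ⟨k, rfl⟩ := (Tuple.sort σ).surjective i
    exact Tuple.monotone_sort σ (Fin.mk_le_of_le_val (Nat.zero_le _))
  · obtain ⟨k, rfl⟩ := (Tuple.sort σ).surjective i
    refine Tuple.monotone_sort σ (Fin.mk_le_of_le_val (Nat.one_le_iff_ne_zero.2 fun h => hi ?_))
    congr 1
    exact Fin.ext h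

theorem exists_kthLargest {N : ℕ} (hN : 2 ≤ N) (σ : Fin N → ℝ) :
    ∃ a b, a ≠ b ∧ kthLargest σ ⟨0, by omega⟩ = σ a ∧ kthLargest σ ⟨1, by omega⟩ = σ b ∧
      (∀ i, σ i ≤ σ a) ∧ ∀ i, i ≠ a → σ i ≤ σ b := by
  refine ⟨_, _, fun h => ?_, rfl, rfl, fun i => ?_, fun i hi => ?_⟩
  · simpa using (Tuple.sort σ).injective h
  · obtain ⟨k, rfl⟩ := (Tuple.sort σ).surjective i
    refine Tuple.monotone_sort σ (Fin.le_def.2 ?_)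
    simp only [Fin.val_rev]
    omega
  · obtain ⟨k, rfl⟩ := (Tuple.sort σ).surjective i
    refine Tuple.monotone_sort σ (Fin.le_def.2 ?_)
    have : (k : ℕ) ≠ N - 1 := fun h => hi <| by
      congr 1
      ext
      simp only [Fin.val_rev]
      omega
    simp only [Fin.val_rev]
    omega

theorem theorem3 {M N : ℕ} (hN : 2 ≤ N) (hMN : N ≤ M)
    (A : Matrix (Fin M) (Fin N) ℝ) (U : Matrix (Fin M) (Fin M) ℝ)
    (σ : Fin N → ℝ) (V : Matrix (Fin N) (Fin N) ℝ) (hA : IsSVD A U σ V)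
    (τ : ℝ) (hτ : 0 ≤ τ)
    -- the singular values are labeled by their distance to the target `τ`, the first one
    -- being strictly closer than the others
    (hlabel : Monotone fun i => |σ i - τ|)
    (hfirst : |σ ⟨0, by omega⟩ - τ| < |σ ⟨1, by omega⟩ - τ|)
    -- the exact singular vectors `u₁` and `v₁`
    (u₁ : Fin M → ℝ) (hu₁ : u₁ = U.col ⟨0, by omega⟩)
    (v₁ : Fin N → ℝ) (hv₁ : v₁ = V.col ⟨0, by omega⟩)
    (r : EuclideanSpace ℝ (Fin M ⊕ Fin N)) (hr : r ≠ 0) (hperp : DoublyOrthogonal r u₁ v₁)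
    (B₁ : EuclideanSpace ℝ (Fin M ⊕ Fin N) →ₗ[ℝ] EuclideanSpace ℝ (Fin M ⊕ Fin N))
    (hB₁ : B₁ = correctionOperator A τ u₁ v₁)
    (σmin σmin2 σmax σmax2 : ℝ)
    (hσmin : σmin = kthSmallest σ ⟨0, by omega⟩) (hσmin2 : σmin2 = kthSmallest σ ⟨1, by omega⟩)
    (hσmax : σmax = kthLargest σ ⟨0, by omega⟩) (hσmax2 : σmax2 = kthLargest σ ⟨1, by omega⟩)
    (j₀ : ℕ) (hj₀ : j₀ = min 1 (M - N)) :
    ((σmax + σmax2) / 2 < τ →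
      σ ⟨0, by omega⟩ = σmax ∧
      ∀ (j : ℕ) (w : EuclideanSpace ℝ (Fin M ⊕ Fin N)), IsMinresIterate B₁ (-r) j w →
        ‖B₁ w + r‖ / ‖r‖ ≤
          2 * (1 - 2 / (1 + √((τ + σmax2) / (τ - σmax2)))) ^ j) ∧
    (0 < τ → σmin ≤ τ → τ < (σmin + σmin2) / 2 →
      σ ⟨0, by omega⟩ = σmin ∧
      ∀ (j : ℕ) (w : EuclideanSpace ℝ (Fin M ⊕ Fin N)), IsMinresIterate B₁ (-r) j w →
        ‖B₁ w + r‖ / ‖r‖ ≤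
          2 * (σmax / τ) ^ j₀ *
            (1 - 2 / (1 + √((σmax ^ 2 - τ ^ 2) / (σmin2 ^ 2 - τ ^ 2)))) ^ ((j - j₀) / 2)) ∧
    ((σmin + σmin2) / 2 < τ → τ < (σmax + σmax2) / 2 →
      σ ⟨0, by omega⟩ ≠ σmax ∧ σ ⟨0, by omega⟩ ≠ σmin ∧
      ∀ (j : ℕ) (w : EuclideanSpace ℝ (Fin M ⊕ Fin N)), IsMinresIterate B₁ (-r) j w →
        ‖B₁ w + r‖ / ‖r‖ ≤
          2 * (1 - 2 / (1 + (σmax + τ) / |τ - σ ⟨1, by omega⟩|)) ^ (j / 2)) := by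
  subst hu₁ hv₁ hB₁ hσmin hσmin2 hσmax hσmax2
  obtain ⟨a, b, hab, ha, hb, hamin, hbmin⟩ := exists_kthSmallest hN σ
  obtain ⟨a', b', hab', ha', hb', hamax, hbmax⟩ := exists_kthLargest hN σ
  rw [ha, hb, ha', hb']
  clear ha hb ha' hb'
  set i₀ : Fin N := ⟨0, by omega⟩ with hi₀
  set i₁ : Fin N := ⟨1, by omega⟩ with hi₁
  have hfar : ∀ i, i ≠ i₀ → |σ i₁ - τ| ≤ |σ i - τ| := fun i hi =>
    hlabel (Fin.mk_le_of_le_val (Nat.one_le_iff_ne_zero.2 fun h => hi (Fin.ext h)))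
  have hclose : ∀ i, i ≠ i₀ → |σ i₀ - τ| < |σ i - τ| := fun i hi => hfirst.trans_le (hfar i hi)
  refine ⟨fun hτ1 => ?_, fun hτ0 hτ1 hτ2 => ?_, fun hτ1 hτ2 => ?_⟩
  · have hba : σ b' ≤ σ a' := hamax b'
    obtain rfl : a' = i₀ := by
      -- Otherwise `σ i₀ ≤ σ b'`, and `τ` above the midpoint of `σ a'` and `σ b'` makes `σ a'` at
      -- least as close to `τ` as `σ i₀`.
      by_contra hne
      have h1 := hclose a' hne
      have h2 := hbmax i₀ (Ne.symm hne)
      rcases abs_cases (σ i₀ - τ) with h | h <;> rcases abs_cases (σ a' - τ) with h' | h' <;>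
        linarith [hamax i₀]
    refine ⟨rfl, fun j w hw => ?_⟩
    have hb0 := hA.nonneg b'
    have hlo : 0 < τ - σ b' := by linarith
    have hle : τ - σ b' ≤ τ + σ b' := by linarith
    obtain ⟨q, hqd, hq0, hq⟩ := exists_polynomial_abs_eval_le hlo hle j
    refine hA.residual_div_le hMN i₀ hperp hw (p := q.comp (-Polynomial.X)) ?_ (by simpa) ?_ fun c hc => ?_
    · simpa [Polynomial.natDegree_comp] using hqd
    · exact mul_nonneg zero_le_two (pow_nonneg (one_sub_two_div_one_add_sqrt_nonneg hlo hle) _)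
    · rw [Polynomial.eval_comp, Polynomial.eval_neg, Polynomial.eval_X]
      rcases hc with ⟨i, hi, hc⟩ | ⟨-, rfl⟩
      · have h1 := abs_le.1 (((sq_eq_sq_iff_abs_eq_abs _ _).1 hc).trans_le
          ((abs_of_nonneg (hA.nonneg i)).trans_le (hbmax i hi)))
        exact hq _ (by linarith) (by linarith)
      · exact hq _ (by linarith) (by linarith)
  · obtain rfl : a = i₀ := by
      by_contra hne
      have h1 := hclose a hne
      have h2 := hbmin i₀ (Ne.symm hne)
      rcases abs_cases (σ i₀ - τ) with h | h <;> rcases abs_cases (σ a - τ) with h' | h' <;>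
        linarith
    refine ⟨rfl, fun j w hw => ?_⟩
    have hτb : τ < σ b := by linarith
    have hba : σ b ≤ σ a' := hamax b
    have hlo : 0 < σ b ^ 2 - τ ^ 2 := by nlinarith
    have hle : σ b ^ 2 - τ ^ 2 ≤ σ a' ^ 2 - τ ^ 2 := by nlinarith
    have hratio : 1 ≤ σ a' / τ := (one_le_div hτ0).2 (by linarith)
    have hρ := one_sub_two_div_one_add_sqrt_nonneg hlo hle
    obtain ⟨q, hqd, hq0, hq⟩ := exists_polynomial_abs_eval_le hlo hle ((j - j₀) / 2)
    rcases Nat.lt_or_ge j j₀ with hj | hj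
    -- Degree `j = 0` leaves no room for the linear factor; truncated subtraction makes the exponent
    -- `0`, and `p = 1` suffices as `σmax / τ ≥ 1`.
    · have hz : (j - j₀) / 2 = 0 := by omega
      rw [hz, pow_zero, mul_one]
      have := one_le_pow₀ hratio (n := j₀)
      refine hA.residual_div_le hMN i₀ hperp hw (p := 1) (by simp) (by simp) (by linarith) fun c _ => ?_
      rw [Polynomial.eval_one, abs_one]
      linarith
    refine hA.residual_div_le hMN i₀ hperp hw (p := (1 + Polynomial.C τ⁻¹ * Polynomial.X) ^ j₀ *
      q.comp (Polynomial.X ^ 2 + Polynomial.C (2 * τ) * Polynomial.X)) ?_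
      (by simp [Polynomial.eval_comp, hq0]) (by positivity) fun c hc => ?_
    · have h1 : (1 + Polynomial.C τ⁻¹ * Polynomial.X : Polynomial ℝ).natDegree ≤ 1 := by
        compute_degree
      have h2 : (Polynomial.X ^ 2 + Polynomial.C (2 * τ) * Polynomial.X :
          Polynomial ℝ).natDegree ≤ 2 := by compute_degree
      have h3 := Polynomial.natDegree_pow_le_of_le j₀ h1
      have h4 := Polynomial.natDegree_comp_le.trans (Nat.mul_le_mul hqd h2)
      refine (Polynomial.natDegree_mul_le_of_le h3 h4).trans ?_
      omega
    · have heval : Polynomial.eval c ((1 + Polynomial.C τ⁻¹ * Polynomial.X) ^ j₀ *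
          q.comp (Polynomial.X ^ 2 + Polynomial.C (2 * τ) * Polynomial.X)) =
          ((c + τ) / τ) ^ j₀ * q.eval ((c + τ) ^ 2 - τ ^ 2) := by
        simp only [Polynomial.eval_mul, Polynomial.eval_pow, Polynomial.eval_add,
          Polynomial.eval_one, Polynomial.eval_C, Polynomial.eval_X, Polynomial.eval_comp]
        congr 2
        · field_simp
          ring
        · ring
      rw [heval]
      rcases hc with ⟨i, hi, hc⟩ | ⟨hlt, rfl⟩
      · have h1 := hbmin i hi
        have h2 := hamax i
        have hci : |c + τ| = σ i := by
          rw [(sq_eq_sq_iff_abs_eq_abs _ _).1 hc, abs_of_nonneg (hA.nonneg i)]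
        have h3 := hq ((c + τ) ^ 2 - τ ^ 2) (by nlinarith) (by nlinarith)
        rw [abs_mul, abs_pow, abs_div, abs_of_pos hτ0, hci]
        calc (σ i / τ) ^ j₀ * _ ≤ (σ a' / τ) ^ j₀ * _ :=
              mul_le_mul (pow_le_pow_left₀ (div_nonneg (hA.nonneg i) hτ) (by gcongr) _) h3
                (abs_nonneg _) (by positivity)
          _ = _ := by ring
      -- `N < M` gives `j₀ = 1`, so the linear factor vanishes at `-τ`.
      · have hj1 : j₀ ≠ 0 := by omega
        rw [neg_add_cancel, zero_div, zero_pow hj1, zero_mul, abs_zero]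
        positivity
  · have hmax : σ i₀ ≠ σ a' := fun h => by
      -- A tie at the maximum would contradict the strictness in `hclose`. So `σ b'` is strictly
      -- farther from `τ` than `σ i₀ = σ a'`, which puts `τ` above their midpoint.
      have hne : b' ≠ i₀ := by
        rintro rfl
        have := hclose a' hab'
        rw [h] at this
        exact this.false
      have h1 := hclose b' hne
      have h2 := hamax b'
      rcases abs_cases (σ i₀ - τ) with h3 | h3 <;> rcases abs_cases (σ b' - τ) with h4 | h4 <;>
        linarith
    have hmin : σ i₀ ≠ σ a := fun h => by
      have hne : b ≠ i₀ := by
        rintro rfl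
        have := hclose a hab
        rw [h] at this
        exact this.false
      have h1 := hclose b hne
      have h2 := hamin b
      rcases abs_cases (σ i₀ - τ) with h3 | h3 <;> rcases abs_cases (σ b - τ) with h4 | h4 <;>
        linarith
    refine ⟨hmax, hmin, fun j w hw => ?_⟩
    rw [abs_sub_comm τ]
    set δ := |σ i₁ - τ| with hδ
    have hδ0 : 0 < δ := (abs_nonneg _).trans_lt hfirst
    have hfari : ∀ i, i ≠ i₀ → δ ≤ σ i + τ := fun i hi =>
      (hfar i hi).trans (abs_le.2 ⟨by linarith [hA.nonneg i], by linarith⟩)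
    -- Needed for the eigenvalue `-τ`: the smallest value is not the one closest to `τ` and lies
    -- below `τ`, whence `δ ≤ τ - σ a ≤ τ`.
    have hδτ : δ ≤ τ := by
      have h1 := hfar a (fun h => hmin (by rw [h]))
      have h2 := hamin b
      rw [abs_of_nonpos (by linarith)] at h1
      linarith [hA.nonneg a]
    have hδs : δ ≤ σ a' + τ := by linarith [hA.nonneg a']
    have hlo : 0 < δ ^ 2 := by positivity
    have hle : δ ^ 2 ≤ (σ a' + τ) ^ 2 := pow_le_pow_left₀ hδ0.le hδs 2
    -- Squaring the eigenvalues squares the interval ratio, so no root survives in the rate.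
    have hsqrt : √((σ a' + τ) ^ 2 / δ ^ 2) = (σ a' + τ) / δ := by
      rw [← div_pow, Real.sqrt_sq (div_nonneg (hδ0.le.trans hδs) hδ0.le)]
    have hρ := one_sub_two_div_one_add_sqrt_nonneg hlo hle
    obtain ⟨q, hqd, hq0, hq⟩ := exists_polynomial_abs_eval_le hlo hle (j / 2)
    rw [hsqrt] at hρ hq
    refine hA.residual_div_le hMN i₀ hperp hw (p := q.comp (Polynomial.X ^ 2)) ?_ (by simpa [Polynomial.eval_comp])
      (by positivity) fun c hc => ?_
    · rw [Polynomial.natDegree_comp, Polynomial.natDegree_X_pow]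
      omega
    · rw [Polynomial.eval_comp, Polynomial.eval_pow, Polynomial.eval_X]
      suffices h : δ ≤ |c| ∧ |c| ≤ σ a' + τ by
        rw [← sq_abs c]
        exact hq _ (pow_le_pow_left₀ hδ0.le h.1 2) (pow_le_pow_left₀ (abs_nonneg c) h.2 2)
      rcases hc with ⟨i, hi, hc⟩ | ⟨-, rfl⟩
      · have h0 := hA.nonneg i
        have h2 := hamax i
        rcases sq_eq_sq_iff_eq_or_eq_neg.1 hc with h | h
        · obtain rfl : c = σ i - τ := by linarith
          exact ⟨hfar i hi, abs_le.2 ⟨by linarith, by linarith⟩⟩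
        · obtain rfl : c = -(σ i + τ) := by linarith
          rw [abs_neg, abs_of_nonneg (by linarith)]
          exact ⟨hfari i hi, by linarith⟩
      · rw [abs_neg, abs_of_nonneg hτ]
        exact ⟨hδτ, by linarith [hA.nonneg a']⟩
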